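/- Let $\mathbb D=\{z\in\mathbb C:|z|<1\}$, let $\mathbb N_0=\{0,1,2,\dots\}$, and let $A^{-\infty}$ be the Korenblum space of all holomorphic functions $f$ on $\mathbb D$ such that $\sup_{z\in\mathbb D}(1-|z|)^n|f(z)|<\infty$ for some integer $n\ge 1$. It carries its (LB)-topology, that is, the finest locally convex topology for which all the inclusions $H_{v_n}^\infty\subseteq A^{-\infty}$, $n\ge1$, are continuous, where $H_{v_n}^\infty$ is the Banach space of all holomorphic functions $f$ on $\mathbb D$ with $\|f\|_n:=\sup_{z\in\mathbb D}(1-|z|)^n|f(z)|<\infty$. Let $\mu$ be a finite positive Borel measure on $[0,1)$ with $\mu((0,1))>0$, with moments $\mu_n:=\int_0^1t^n\,d\mu(t)$, $n\in\mathbb N_0$. Suppose that $\mu$ is a Carleson measure, i.e. there is a constant $C$ with $\mu([t,1))\le C(1-t)$ for all $t\in[0,1)$. Then the Cesàro-type operator $$C_\mu\Bigl(\sum_{n=0}^\infty a_nz^n\Bigr)=\sum_{n=0}^\infty\mu_n\Bigl(\sum_{k=0}^na_k\Bigr)z^n$$ is a well-defined continuous linear operator on $A^{-\infty}$. Let its spectrum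 $\sigma(C_\mu,A^{-\infty})$ be the set of $\lambda\in\mathbb C$ for which $\lambda I-C_\mu$ has no continuous linear inverse on $A^{-\infty}$, its resolvent set the complement of the spectrum in $\mathbb C$, and its point spectrum $\sigma_p(C_\mu,A^{-\infty})$ the set of $\lambda\in\mathbb C$ for which $\lambda I-C_\mu$ is not injective. Then $$\sigma(C_\mu,A^{-\infty})\setminus\{0\}=\{\mu_n:n\in\mathbb N_0\}=\sigma_p(C_\mu,A^{-\infty}),$$ and every $\lambda\in\mathbb C\setminus(\{\mu_n:n\in\mathbb N_0\}\cup\{0\})$ belongs to the resolvent set of $C_\mu$ on $A^{-\infty}$. -/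

import Mathlib

open MeasureTheory
open scoped Complex.UnitDisc

noncomputable section

namespace KorenblumCesaro

/-- The extension of a function on the unit disc to the plane by zero. -/
def extendZero (f : 𝔻 → ℂ) : ℂ → ℂ :=
  Function.extend (fun z : 𝔻 => (z : ℂ)) f 0

theorem extendZero_apply (f : 𝔻 → ℂ) {w : ℂ} (hw : w ∈ Metric.ball (0 : ℂ) 1) :
    extendZero f w = f (Complex.UnitDisc.mk w (mem_ball_zero_iff.1 hw)) :=
  Complex.UnitDisc.coe_injective.extend_apply f 0
    (Complex.UnitDisc.mk w (mem_ball_zero_iff.1 hw))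

/-- `H(𝔻)`: the vector space of holomorphic functions on the unit disc. -/
def holomorphic : Submodule ℂ (𝔻 → ℂ) where
  carrier := {f | DifferentiableOn ℂ (extendZero f) (Metric.ball 0 1)}
  zero_mem' := (differentiableOn_const (0 : ℂ)).congr fun _ hw => by
    rw [extendZero_apply _ hw]; rfl
  add_mem' {f g} hf hg := (DifferentiableOn.add hf hg).congr fun _ hw => by
    rw [Pi.add_apply, extendZero_apply _ hw, extendZero_apply _ hw, extendZero_apply _ hw]; rfl
  smul_mem' c f hf := (DifferentiableOn.const_smul hf c).congr fun _ hw => by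
    rw [Pi.smul_apply, extendZero_apply _ hw, extendZero_apply _ hw]; rfl

/-- The standard weight `v_n(z) = (1 - |z|)ⁿ`. -/
def weight (n : ℕ) (z : 𝔻) : ℝ := (1 - ‖(z : ℂ)‖) ^ n

theorem weight_pos (n : ℕ) (z : 𝔻) : 0 < weight n z :=
  pow_pos (sub_pos.2 z.norm_lt_one) n

theorem weight_succ_le (n : ℕ) (z : 𝔻) : weight (n + 1) z ≤ weight n z :=
  pow_le_pow_of_le_one (sub_nonneg.2 z.norm_lt_one.le)
    (sub_le_self _ (norm_nonneg _)) n.le_succ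

theorem weight_anti {m n : ℕ} (h : m ≤ n) (z : 𝔻) : weight n z ≤ weight m z :=
  antitone_nat_of_succ_le (f := fun k => weight k z) (fun k => weight_succ_le k z) h

/-- The holomorphic functions `f` on the disc with `sup_z (1 - |z|)ⁿ |f(z)| < ∞`. -/
def growthSubmodule (n : ℕ) : Submodule ℂ (𝔻 → ℂ) where
  carrier := {f | f ∈ holomorphic ∧ BddAbove (Set.range fun z => weight n z * ‖f z‖)}
  zero_mem' := ⟨holomorphic.zero_mem, 0, by rintro _ ⟨z, rfl⟩; simp⟩
  add_mem' := by
    rintro f g ⟨hf, A, hA⟩ ⟨hg, B, hB⟩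
    refine ⟨holomorphic.add_mem hf hg, A + B, ?_⟩
    rintro _ ⟨z, rfl⟩
    calc weight n z * ‖(f + g) z‖ ≤ weight n z * (‖f z‖ + ‖g z‖) :=
          mul_le_mul_of_nonneg_left (norm_add_le _ _) (weight_pos n z).le
      _ = weight n z * ‖f z‖ + weight n z * ‖g z‖ := mul_add _ _ _
      _ ≤ A + B := add_le_add (hA ⟨z, rfl⟩) (hB ⟨z, rfl⟩)
  smul_mem' := by
    rintro c f ⟨hf, A, hA⟩
    refine ⟨holomorphic.smul_mem c hf, ‖c‖ * A, ?_⟩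
    rintro _ ⟨z, rfl⟩
    calc weight n z * ‖(c • f) z‖ = ‖c‖ * (weight n z * ‖f z‖) := by
          rw [Pi.smul_apply, norm_smul]; ring
      _ ≤ ‖c‖ * A := mul_le_mul_of_nonneg_left (hA ⟨z, rfl⟩) (norm_nonneg c)

/-- The growth space `H_{v_n}^∞`. It is a type of its own, so that it carries
the norm topology and not that of pointwise convergence. -/
def GrowthSpace (n : ℕ) : Type := growthSubmodule n

namespace GrowthSpace

variable {n : ℕ}

instance : AddCommGroup (GrowthSpace n) := inferInstanceAs (AddCommGroup (growthSubmodule n))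
instance : Module ℂ (GrowthSpace n) := inferInstanceAs (Module ℂ (growthSubmodule n))
instance : CoeFun (GrowthSpace n) (fun _ => 𝔻 → ℂ) := ⟨fun f => f.1⟩

/-- `‖f‖ = sup_z (1 - |z|)ⁿ |f(z)|`. -/
instance : Norm (GrowthSpace n) := ⟨fun f => ⨆ z : 𝔻, weight n z * ‖f z‖⟩

theorem norm_def (f : GrowthSpace n) : ‖f‖ = ⨆ z : 𝔻, weight n z * ‖f z‖ := rfl

theorem le_norm (f : GrowthSpace n) (z : 𝔻) : weight n z * ‖f z‖ ≤ ‖f‖ :=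
  le_ciSup f.2.2 z

theorem norm_le (f : GrowthSpace n) {A : ℝ} (h : ∀ z, weight n z * ‖f z‖ ≤ A) : ‖f‖ ≤ A :=
  have : Nonempty 𝔻 := ⟨0⟩
  ciSup_le h

theorem core : NormedSpace.Core ℂ (GrowthSpace n) where
  norm_nonneg f := Real.iSup_nonneg fun z => mul_nonneg (weight_pos n z).le (norm_nonneg _)
  norm_smul c f := by
    rw [norm_def, norm_def, Real.mul_iSup_of_nonneg (norm_nonneg c)]
    refine iSup_congr fun z => ?_
    change weight n z * ‖c • f z‖ = _
    rw [norm_smul]; ring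
  norm_triangle f g := by
    refine norm_le _ fun z => ?_
    calc weight n z * ‖f z + g z‖ ≤ weight n z * (‖f z‖ + ‖g z‖) :=
          mul_le_mul_of_nonneg_left (norm_add_le _ _) (weight_pos n z).le
      _ = weight n z * ‖f z‖ + weight n z * ‖g z‖ := mul_add _ _ _
      _ ≤ ‖f‖ + ‖g‖ := add_le_add (le_norm f z) (le_norm g z)
  norm_eq_zero_iff f := by
    constructor
    · intro h
      refine Subtype.ext (funext fun z => norm_eq_zero.1 (le_antisymm ?_ (norm_nonneg _)))
      have h1 := le_norm f z
      rw [h] at h1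
      exact nonpos_of_mul_nonpos_right h1 (weight_pos n z)
    · rintro rfl
      refine le_antisymm (norm_le _ fun z => ?_)
        (Real.iSup_nonneg fun z => mul_nonneg (weight_pos n z).le (norm_nonneg _))
      change weight n z * ‖(0 : ℂ)‖ ≤ 0
      simp

instance : NormedAddCommGroup (GrowthSpace n) := NormedAddCommGroup.ofCore core
instance : NormedSpace ℂ (GrowthSpace n) := NormedSpace.ofCore core

end GrowthSpace

theorem growthSubmodule_mono : Monotone growthSubmodule := by
  rintro m n h f ⟨hf, A, hA⟩
  refine ⟨hf, A, ?_⟩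
  rintro _ ⟨z, rfl⟩
  exact (mul_le_mul_of_nonneg_right (weight_anti h z) (norm_nonneg _)).trans (hA ⟨z, rfl⟩)

/-- The holomorphic functions `f` on the disc with `sup_z (1 - |z|)ⁿ |f(z)| < ∞` for some
`n ∈ {1, 2, …}`. The variable `n` of the code starts at `0` and stands for the exponent `n + 1`. -/
def korenblumSubmodule : Submodule ℂ (𝔻 → ℂ) where
  carrier := {f | ∃ n : ℕ, f ∈ growthSubmodule (n + 1)}
  zero_mem' := ⟨0, Submodule.zero_mem _⟩
  add_mem' := by
    rintro f g ⟨m, hf⟩ ⟨n, hg⟩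
    exact ⟨max m n, Submodule.add_mem _
      (growthSubmodule_mono (Nat.succ_le_succ (le_max_left m n)) hf)
      (growthSubmodule_mono (Nat.succ_le_succ (le_max_right m n)) hg)⟩
  smul_mem' := by
    rintro c f ⟨n, hf⟩
    exact ⟨n, Submodule.smul_mem _ c hf⟩

/-- The Korenblum space `A^{-∞}`. It is a type of its own, so that it carries the inductive limit
topology and not that of pointwise convergence. -/
def Korenblum : Type := korenblumSubmodule

namespace Korenblum

instance : AddCommGroup Korenblum := inferInstanceAs (AddCommGroup korenblumSubmodule)
instance : Module ℂ Korenblum := inferInstanceAs (Module ℂ korenblumSubmodule)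
instance : CoeFun Korenblum (fun _ => 𝔻 → ℂ) := ⟨fun f => f.1⟩

/-- The inclusion of the step `H_{v_{n+1}}^∞` in `A^{-∞}`. -/
def incl (n : ℕ) : GrowthSpace (n + 1) →ₗ[ℂ] Korenblum where
  toFun f := ⟨f.1, n, f.2⟩
  map_add' _ _ := rfl
  map_smul' _ _ := rfl

/-- The locally convex vector space topologies on `A^{-∞}` for which all the inclusions
`H_{v_n}^∞ ⊆ A^{-∞}`, `n ≥ 1`, are continuous. -/
def admissibleTopologies : Set (TopologicalSpace Korenblum) :=
  {t | @IsTopologicalAddGroup Korenblum t _ ∧ @ContinuousSMul ℂ Korenblum _ _ t ∧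
    @LocallyConvexSpace ℝ Korenblum _ _ _ _ t ∧ ∀ n, @Continuous _ _ _ t (incl n)}

/-- The inductive limit topology, i.e. the finest admissible one. (In Mathlib's order on
topologies, finer means smaller.) -/
instance : TopologicalSpace Korenblum := sInf admissibleTopologies

instance : IsTopologicalAddGroup Korenblum := topologicalAddGroup_sInf fun _ ht => ht.1

instance : ContinuousSMul ℂ Korenblum := continuousSMul_sInf fun _ ht => ht.2.1

instance : LocallyConvexSpace ℝ Korenblum := LocallyConvexSpace.sInf fun _ ht => ht.2.2.1

theorem continuous_incl (n : ℕ) : Continuous (incl n) :=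
  continuous_sInf_rng.2 fun _ ht => ht.2.2.2 n

/-- The inductive limit topology is itself admissible, hence the finest admissible topology. -/
theorem isLeast_topology :
    IsLeast admissibleTopologies (inferInstance : TopologicalSpace Korenblum) :=
  ⟨⟨inferInstance, inferInstance, inferInstance, continuous_incl⟩, fun _ ht => sInf_le ht⟩

end Korenblum

/-- The `n`-th Taylor coefficient at `0` of a holomorphic function on the disc. -/
def coeff (f : 𝔻 → ℂ) (n : ℕ) : ℂ :=
  iteratedDeriv n (extendZero f) 0 / (n.factorial : ℂ)

/-- The `n`-th moment `∫ tⁿ dμ(t)` of a measure on `[0,1)`. -/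
def moment (μ : Measure (Set.Ico (0 : ℝ) 1)) (n : ℕ) : ℝ :=
  ∫ t : Set.Ico (0 : ℝ) 1, (t : ℝ) ^ n ∂μ

/-- Carleson measures: `μ([t,1)) = O(1 - t)`, `0 ≤ t < 1`. -/
def IsCarleson (μ : Measure (Set.Ico (0 : ℝ) 1)) : Prop :=
  ∃ C : ℝ, ∀ t : Set.Ico (0 : ℝ) 1, μ.real (Set.Ici t) ≤ C * (1 - (t : ℝ))

/-- `T` is the Cesàro-type operator `C_μ` on `A^{-∞}`: if `f(z) = ∑ aₙ zⁿ`, then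
`(T f)(z) = ∑ μₙ (∑_{k ≤ n} a_k) zⁿ` for all `z` in the disc (with convergence of the series).
There is at most one such `T`. -/
def IsCesaroOperator (μ : Measure (Set.Ico (0 : ℝ) 1)) (T : Korenblum →L[ℂ] Korenblum) : Prop :=
  ∀ (f : Korenblum) (z : 𝔻),
    HasSum (fun n : ℕ => (moment μ n : ℂ) * (∑ k ∈ Finset.range (n + 1), coeff f k) * (z : ℂ) ^ n)
      (T f z)

/-- The point spectrum: all `c` for which `c I - T` is not injective. -/
def pointSpectrum {E : Type*} [AddCommGroup E] [Module ℂ E] [TopologicalSpace E]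
    (T : E →L[ℂ] E) : Set ℂ :=
  {c | ¬ Function.Injective fun x : E => c • x - T x}

end KorenblumCesaro

end

namespace KorenblumCesaro

open Filter Topology

/-! ### Taylor coefficients of functions in the Korenblum space -/

/-! A holomorphic function lies in `A^{-∞}` exactly when its Taylor coefficients grow polynomially,
with quantitative bounds both ways (`polyBound_coeff`, `PolyBound.weight_mul_norm_tsum_le`). Hence a
linear map of sequences that raises polynomial growth in a controlled way is a continuous operator
on `A^{-∞}` (`Korenblum.exists_continuousLinearMap`), and the problem becomes one about sequences.

Write `m n` for the moments and `Sₙ` for the partial sums of `b`. Then `c b - C b = a` reads `c (Sₙ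
- Sₙ₋₁) - mₙ Sₙ = aₙ`, that is, `Sₙ = rₙ (Sₙ₋₁ + aₙ / c)` with `rₙ = c / (c - mₙ)`. The Carleson
condition gives `mₙ = O(1/n)`, so `rₙ = 1 + O(1/n)` and products of the `rₙ` grow at most
polynomially (`polyBound_resolventSeq`). This yields the resolvent for `c` outside the moments and
`0`.

If `c = m_p`, the same recursion with `r_p` replaced by `1` and right-hand side `e_p` gives an
eigenvector of polynomial growth (`exists_cesaroSeq_eigenvector`). Finally `0` is no eigenvalue
because no moment vanishes. -/

theorem extendZero_coe (f : 𝔻 → ℂ) (z : 𝔻) : extendZero f z = f z :=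
  Complex.UnitDisc.coe_injective.extend_apply f 0 z

/-- `|aₙ| ≤ A (n + 1)ᵏ` for all `n`. -/
def PolyBound (k : ℕ) (A : ℝ) (a : ℕ → ℂ) : Prop :=
  ∀ n, ‖a n‖ ≤ A * ((n : ℝ) + 1) ^ k

theorem PolyBound.nonneg {k : ℕ} {A : ℝ} {a : ℕ → ℂ} (h : PolyBound k A a) : 0 ≤ A := by
  simpa using (norm_nonneg _).trans (h 0)

theorem hasSum_coeff {f : 𝔻 → ℂ} (hf : f ∈ holomorphic) (z : 𝔻) :
    HasSum (fun n => coeff f n * (z : ℂ) ^ n) (f z) := by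
  have h := Complex.hasSum_taylorSeries_on_ball (f := extendZero f) hf
    (z := z) (mem_ball_zero_iff.2 z.norm_lt_one)
  rw [extendZero_coe] at h
  refine h.congr_fun fun n => ?_
  simp only [coeff, sub_zero, smul_eq_mul]
  ring

theorem hasFPowerSeriesOnBall_of_hasSum {a : ℕ → ℂ} {f : 𝔻 → ℂ}
    (h : ∀ z : 𝔻, HasSum (fun n => a n * (z : ℂ) ^ n) (f z)) :
    HasFPowerSeriesOnBall (extendZero f) (FormalMultilinearSeries.ofScalars ℂ a) 0 1 where
  r_le := by
    refine ENNReal.le_of_forall_nnreal_lt fun r hr => ?_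
    have hr : r < 1 := by exact_mod_cast hr
    refine FormalMultilinearSeries.le_radius_of_summable_norm _ ?_
    have h1 := (h (Complex.UnitDisc.mk (r : ℝ) (by simpa using hr))).summable.norm
    simpa [FormalMultilinearSeries.ofScalars_norm] using h1
  r_pos := one_pos
  hasSum {y} hy := by
    have hy : ‖y‖ < 1 := by simpa [Metric.mem_eball, edist_zero_right, ← ofReal_norm] using hy
    have h1 := h (Complex.UnitDisc.mk y hy)
    rw [← extendZero_coe f] at h1
    simpa [FormalMultilinearSeries.ofScalars_apply_eq, mul_comm] using h1

theorem mem_holomorphic_of_hasSum {a : ℕ → ℂ} {f : 𝔻 → ℂ}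
    (h : ∀ z : 𝔻, HasSum (fun n => a n * (z : ℂ) ^ n) (f z)) : f ∈ holomorphic := by
  have h1 := (hasFPowerSeriesOnBall_of_hasSum h).differentiableOn
  rwa [← ENNReal.ofReal_one, Metric.eball_ofReal] at h1

theorem coeff_eq_of_hasSum {a : ℕ → ℂ} {f : 𝔻 → ℂ}
    (h : ∀ z : 𝔻, HasSum (fun n => a n * (z : ℂ) ^ n) (f z)) : coeff f = a := by
  have h1 := (hasFPowerSeriesOnBall_of_hasSum h).hasFPowerSeriesAt
  have h2 := h1.eq_formalMultilinearSeries h1.analyticAt.hasFPowerSeriesAt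
  exact ((FormalMultilinearSeries.ofScalars_series_eq_iff ..).1 h2).symm

/-- Cauchy's estimate on the circle of radius `r = (n+1)/(n+2)`: there `(1 - r)⁻¹ = n + 2 ≤ 2 (n +
1)`, while `r⁻ⁿ ≤ e < 3`. -/
theorem polyBound_coeff {N : ℕ} {f : 𝔻 → ℂ} (hf : f ∈ holomorphic) {B : ℝ}
    (hB : ∀ z, weight N z * ‖f z‖ ≤ B) : PolyBound N (3 * 2 ^ N * B) (coeff f) := by
  intro n
  have hn : (0 : ℝ) < n + 2 := by positivity
  have hB0 : 0 ≤ B := (mul_nonneg (weight_pos N 0).le (norm_nonneg _)).trans (hB 0)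
  set r : ℝ := ((n : ℝ) + 1) / (n + 2) with hr
  have hr0 : 0 < r := by positivity
  have hr1 : r < 1 := (div_lt_one hn).2 (by linarith)
  have h1r : 1 - r = ((n : ℝ) + 2)⁻¹ := by rw [hr]; field_simp; ring
  have hd : DiffContOnCl ℂ (extendZero f) (Metric.ball 0 r) := by
    refine DifferentiableOn.diffContOnCl ?_
    rw [closure_ball _ hr0.ne']
    exact DifferentiableOn.mono hf (Metric.closedBall_subset_ball hr1)
  have hs : ∀ z ∈ Metric.sphere (0 : ℂ) r, ‖extendZero f z‖ ≤ B * ((n : ℝ) + 2) ^ N := by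
    intro z hz
    have hz : ‖z‖ = r := by simpa using hz
    have h1 := hB (Complex.UnitDisc.mk z (hz ▸ hr1))
    rw [← extendZero_coe f, weight] at h1
    simp only [Complex.UnitDisc.coe_mk, hz, h1r, inv_pow] at h1
    rwa [inv_mul_le_iff₀ (by positivity), mul_comm] at h1
  have h2 := Complex.norm_iteratedDeriv_le_of_forall_mem_sphere_norm_le n hr0 hd hs
  have hinv : (r ^ n)⁻¹ ≤ 3 := by
    have h3 : r⁻¹ ≤ Real.exp (((n : ℝ) + 1)⁻¹) := by
      refine le_trans (le_of_eq ?_) (Real.add_one_le_exp _)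
      rw [hr]; field_simp; ring
    calc (r ^ n)⁻¹ = r⁻¹ ^ n := (inv_pow _ _).symm
      _ ≤ Real.exp (((n : ℝ) + 1)⁻¹) ^ n := pow_le_pow_left₀ (by positivity) h3 n
      _ = Real.exp (n * ((n : ℝ) + 1)⁻¹) := (Real.exp_nat_mul _ _).symm
      _ ≤ Real.exp 1 := by
          refine Real.exp_le_exp.2 ?_
          rw [mul_inv_le_iff₀ (by positivity)]; linarith
      _ ≤ 3 := Real.exp_one_lt_three.le
  have hfac : (0 : ℝ) < n.factorial := by exact_mod_cast n.factorial_pos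
  calc ‖coeff f n‖ = ‖iteratedDeriv n (extendZero f) 0‖ / n.factorial := by
        rw [coeff, norm_div, Complex.norm_natCast]
    _ ≤ (n.factorial * (B * ((n : ℝ) + 2) ^ N) / r ^ n) / n.factorial := by gcongr
    _ = (r ^ n)⁻¹ * (B * ((n : ℝ) + 2) ^ N) := by field_simp
    _ ≤ 3 * (B * (2 * ((n : ℝ) + 1)) ^ N) := by gcongr; linarith
    _ = 3 * 2 ^ N * B * ((n : ℝ) + 1) ^ N := by rw [mul_pow]; ring

/-- Binomials replace powers because `∑ (n+k choose k) xⁿ = (1 - x)^{-(k+1)}` is exactly the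
reciprocal of a weight. -/
theorem add_one_pow_le_factorial_mul_choose (n k : ℕ) :
    ((n : ℝ) + 1) ^ k ≤ k.factorial * ((n + k).choose k : ℝ) := by
  have h := Nat.pow_succ_le_ascFactorial (n + 1) k
  rw [Nat.ascFactorial_eq_factorial_mul_choose] at h
  exact_mod_cast h

theorem PolyBound.norm_mul_pow_le {k : ℕ} {A : ℝ} {a : ℕ → ℂ} (h : PolyBound k A a) (z : 𝔻)
    (n : ℕ) : ‖a n * (z : ℂ) ^ n‖ ≤
      A * k.factorial * (((n + k).choose k : ℝ) * ‖(z : ℂ)‖ ^ n) := by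
  have hA := h.nonneg
  calc ‖a n * (z : ℂ) ^ n‖ = ‖a n‖ * ‖(z : ℂ)‖ ^ n := by rw [norm_mul, norm_pow]
    _ ≤ A * (k.factorial * ((n + k).choose k : ℝ)) * ‖(z : ℂ)‖ ^ n := by
        gcongr
        exact (h n).trans (mul_le_mul_of_nonneg_left (add_one_pow_le_factorial_mul_choose n k) hA)
    _ = _ := by ring

theorem PolyBound.hasSum {k : ℕ} {A : ℝ} {a : ℕ → ℂ} (h : PolyBound k A a) (z : 𝔻) :
    HasSum (fun n => a n * (z : ℂ) ^ n) (∑' n, a n * (z : ℂ) ^ n) := by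
  have hz : ‖(‖(z : ℂ)‖ : ℝ)‖ < 1 := by simpa using z.norm_lt_one
  exact (Summable.of_norm_bounded
    ((summable_choose_mul_geometric_of_norm_lt_one k hz).mul_left (A * k.factorial))
    (h.norm_mul_pow_le z)).hasSum

theorem PolyBound.weight_mul_norm_tsum_le {k : ℕ} {A : ℝ} {a : ℕ → ℂ} (h : PolyBound k A a)
    (z : 𝔻) : weight (k + 1) z * ‖∑' n, a n * (z : ℂ) ^ n‖ ≤ A * k.factorial := by
  have hz : ‖(‖(z : ℂ)‖ : ℝ)‖ < 1 := by simpa using z.norm_lt_one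
  have h1 := tsum_of_norm_bounded
    ((hasSum_choose_mul_geometric_of_norm_lt_one k hz).mul_left (A * k.factorial))
    (h.norm_mul_pow_le z)
  have hw := weight_pos (k + 1) z
  calc _ ≤ weight (k + 1) z * (A * k.factorial * (1 / weight (k + 1) z)) :=
        mul_le_mul_of_nonneg_left h1 hw.le
    _ = A * k.factorial := by field_simp

theorem PolyBound.mem_growthSubmodule {k : ℕ} {A : ℝ} {a : ℕ → ℂ} (h : PolyBound k A a) :
    (fun z : 𝔻 => ∑' n, a n * (z : ℂ) ^ n) ∈ growthSubmodule (k + 1) :=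
  ⟨mem_holomorphic_of_hasSum h.hasSum, A * k.factorial, by
    rintro _ ⟨z, rfl⟩; exact h.weight_mul_norm_tsum_le z⟩

/-! ### Continuous operators on `A^{-∞}` from maps of coefficient sequences -/

namespace Korenblum

theorem mem_holomorphic (f : Korenblum) : (f : 𝔻 → ℂ) ∈ holomorphic := by
  obtain ⟨n, hn⟩ := f.2
  exact hn.1

theorem exists_polyBound_coeff (f : Korenblum) : ∃ k A, PolyBound k A (coeff f) := by
  obtain ⟨n, hn, B, hB⟩ := f.2
  exact ⟨_, _, polyBound_coeff hn fun z => hB ⟨z, rfl⟩⟩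

theorem ext_coeff {f g : Korenblum} (h : coeff f = coeff g) : f = g := by
  refine Subtype.ext (funext fun z => ?_)
  have h1 := hasSum_coeff f.mem_holomorphic z
  rw [h] at h1
  exact h1.unique (hasSum_coeff g.mem_holomorphic z)

/-- The sequence of Taylor coefficients, as a linear map. -/
noncomputable def coeffLM : Korenblum →ₗ[ℂ] (ℕ → ℂ) where
  toFun f := coeff f
  map_add' f g := coeff_eq_of_hasSum fun z => by
    have := (hasSum_coeff f.mem_holomorphic z).add (hasSum_coeff g.mem_holomorphic z)
    refine this.congr_fun fun n => ?_
    simp [add_mul]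
  map_smul' c f := coeff_eq_of_hasSum fun z => by
    have := (hasSum_coeff f.mem_holomorphic z).mul_left c
    refine this.congr_fun fun n => ?_
    simp [mul_assoc]

theorem coeffLM_apply (f : Korenblum) : coeffLM f = coeff f := rfl

theorem coeffLM_injective : Function.Injective coeffLM := fun _ _ h => ext_coeff h

theorem mem_range_coeffLM {k : ℕ} {A : ℝ} {a : ℕ → ℂ} (h : PolyBound k A a) :
    a ∈ LinearMap.range coeffLM :=
  ⟨⟨_, k, h.mem_growthSubmodule⟩, coeff_eq_of_hasSum h.hasSum⟩

/-- The topology induced by `T` is admissible, so the finest admissible topology refines it. -/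
theorem continuous_of_continuous_comp_incl (T : Korenblum →ₗ[ℂ] Korenblum)
    (h : ∀ n, Continuous (T ∘ₗ incl n)) : Continuous T := by
  refine continuous_iff_le_induced.2 (sInf_le ⟨?_, ?_, ?_, fun n => ?_⟩)
  · exact topologicalAddGroup_induced T
  · exact continuousSMul_induced T
  · exact LocallyConvexSpace.induced (T.restrictScalars ℝ)
  · exact continuous_induced_rng.2 (h n)

/-- A linear map between sequence spaces that respects polynomial growth, with control of the
constants, acts on the Taylor coefficients of a continuous linear operator on `A^{-∞}`. -/
theorem exists_continuousLinearMap (L : (ℕ → ℂ) →ₗ[ℂ] (ℕ → ℂ))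
    (hL : ∀ k, ∃ k' C, ∀ a A, PolyBound k A a → PolyBound k' (C * A) (L a)) :
    ∃ T : Korenblum →L[ℂ] Korenblum, ∀ f, coeffLM (T f) = L (coeffLM f) := by
  have hex : ∀ f : Korenblum, ∃ g : Korenblum, coeffLM g = L (coeffLM f) := fun f => by
    obtain ⟨k, A, h⟩ := f.exists_polyBound_coeff
    obtain ⟨k', C, hC⟩ := hL k
    exact mem_range_coeffLM (hC _ _ h)
  choose T hT using hex
  let T' : Korenblum →ₗ[ℂ] Korenblum :=
    { toFun := T
      map_add' := fun f g => coeffLM_injective (by simp [hT])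
      map_smul' := fun c f => coeffLM_injective (by simp [hT]) }
  refine ⟨⟨T', continuous_of_continuous_comp_incl T' fun n => ?_⟩, hT⟩
  obtain ⟨k', C, hC⟩ := hL (n + 1)
  have hb (f : GrowthSpace (n + 1)) :
      PolyBound k' (C * (3 * 2 ^ (n + 1) * ‖f‖)) (L (coeffLM (incl n f))) :=
    hC _ _ (polyBound_coeff f.2.1 f.le_norm)
  have hv (f : GrowthSpace (n + 1)) (z : 𝔻) :
      T (incl n f) z = ∑' m, L (coeffLM (incl n f)) m * (z : ℂ) ^ m := by
    rw [← hT]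
    exact (hasSum_coeff (T (incl n f)).mem_holomorphic z).tsum_eq.symm
  have hmem (f : GrowthSpace (n + 1)) : (T (incl n f)).1 ∈ growthSubmodule (k' + 1) := by
    rw [funext (hv f)]
    exact (hb f).mem_growthSubmodule
  -- Since `k'` and `C` depend only on the exponent `n + 1`, the whole step is mapped into one
  -- single step, with a bound on the norm.
  let G : GrowthSpace (n + 1) →ₗ[ℂ] GrowthSpace (k' + 1) :=
    { toFun := fun f => ⟨_, hmem f⟩
      map_add' := fun f g => Subtype.ext (congrArg (fun h : Korenblum => h.1) (T'.map_add (incl n f) (incl n g)))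
      map_smul' := fun c f => Subtype.ext (congrArg (fun h : Korenblum => h.1) (T'.map_smul c (incl n f))) }
  have hG : Continuous G := (G.mkContinuous (C * (3 * 2 ^ (n + 1)) * k'.factorial) fun f => by
    refine GrowthSpace.norm_le _ fun z => ?_
    have h1 := (hb f).weight_mul_norm_tsum_le z
    rw [← hv] at h1
    exact h1.trans_eq (by ring)).continuous
  exact (continuous_incl k').comp hG

end Korenblum

/-! ### Moments -/

section Moments

variable (μ : Measure (Set.Ico (0 : ℝ) 1))

theorem moment_nonneg (n : ℕ) : 0 ≤ moment μ n :=
  integral_nonneg fun t => pow_nonneg t.2.1 n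

variable [IsFiniteMeasure μ]

theorem integrable_pow (n : ℕ) : Integrable (fun t : Set.Ico (0 : ℝ) 1 => (t : ℝ) ^ n) μ := by
  refine Integrable.of_bound (C := 1) (by fun_prop) (ae_of_all _ fun t => ?_)
  rw [norm_pow, Real.norm_of_nonneg t.2.1]
  exact pow_le_one₀ t.2.1 t.2.2.le

variable {μ}

theorem moment_pos (h : 0 < μ {t | 0 < (t : ℝ)}) (n : ℕ) : 0 < moment μ n := by
  rw [moment, integral_pos_iff_support_of_nonneg (fun t => pow_nonneg t.2.1 n)
    (integrable_pow μ n)]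
  refine h.trans_le (measure_mono fun t ht => ?_)
  exact (pow_pos ht n).ne'

/-- The integrand `tⁿ (1 - t)` of the difference is positive on `(0,1)`, which has positive measure.
-/
theorem moment_strictAnti (h : 0 < μ {t | 0 < (t : ℝ)}) : StrictAnti (moment μ) := by
  refine strictAnti_nat_of_succ_lt fun n => ?_
  rw [← sub_pos, moment, moment, ← integral_sub (integrable_pow μ n) (integrable_pow μ (n + 1))]
  have h1 (t : Set.Ico (0 : ℝ) 1) :
      (t : ℝ) ^ n - (t : ℝ) ^ (n + 1) = (t : ℝ) ^ n * (1 - t) := by ring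
  rw [integral_pos_iff_support_of_nonneg]
  · refine h.trans_le (measure_mono fun t ht => ?_)
    rw [Function.mem_support, h1]
    exact (mul_pos (pow_pos ht n) (sub_pos.2 t.2.2)).ne'
  · intro t
    simp only [h1]
    exact mul_nonneg (pow_nonneg t.2.1 n) (sub_nonneg.2 t.2.2.le)
  · exact (integrable_pow μ n).sub (integrable_pow μ (n + 1))

/-- Layer-cake formula: `∫ tⁿ⁺¹ dμ = ∫₀^∞ (n+1) xⁿ μ([x,1)) dx ≤ C ∫₀¹ (n+1) xⁿ (1 - x) dx = C /
(n+2)`. The zeroth moment is the total mass. -/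
theorem IsCarleson.exists_moment_le (hμ : IsCarleson μ) :
    ∃ C, 0 ≤ C ∧ ∀ n : ℕ, moment μ n ≤ C / ((n : ℝ) + 1) := by
  obtain ⟨C, hC⟩ := hμ
  have hC0 : 0 ≤ C := by simpa using measureReal_nonneg.trans (hC ⟨0, by simp⟩)
  refine ⟨C, hC0, fun n => ?_⟩
  rcases n with _ | n
  · have h := hC ⟨0, by simp⟩
    have h0 : Set.Ici (⟨0, by simp⟩ : Set.Ico (0 : ℝ) 1) = Set.univ :=
      Set.eq_univ_of_forall fun t => t.2.1
    rw [h0] at h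
    simpa [moment] using h
  have hlayer := lintegral_comp_eq_lintegral_meas_le_mul μ
    (f := fun t : Set.Ico (0 : ℝ) 1 => (t : ℝ)) (g := fun x => ((n : ℝ) + 1) * x ^ n)
    (ae_of_all _ fun t => t.2.1) (by fun_prop)
    (fun t _ => (by fun_prop : Continuous fun x : ℝ => ((n : ℝ) + 1) * x ^ n).intervalIntegrable _ _)
    ((ae_restrict_mem measurableSet_Ioi).mono fun x (hx : 0 < x) => by positivity)
  have hint (t : ℝ) : ∫ x in (0 : ℝ)..t, ((n : ℝ) + 1) * x ^ n = t ^ (n + 1) := by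
    rw [intervalIntegral.integral_const_mul, integral_pow]
    field_simp
    simp
  simp only [hint] at hlayer
  rw [← ofReal_integral_eq_lintegral_ofReal (integrable_pow μ (n + 1))
    (ae_of_all _ fun t => pow_nonneg t.2.1 _)] at hlayer
  -- The superlevel sets are empty for `x ≥ 1`, which truncates the integral.
  have hbound : ∫⁻ x in Set.Ioi (0 : ℝ), μ {a | x ≤ (a : ℝ)} *
      ENNReal.ofReal (((n : ℝ) + 1) * x ^ n) ≤
      ∫⁻ x in Set.Ioc (0 : ℝ) 1, ENNReal.ofReal (C * (1 - x) * (((n : ℝ) + 1) * x ^ n)) := by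
    rw [← lintegral_indicator measurableSet_Ioi, ← lintegral_indicator measurableSet_Ioc]
    refine lintegral_mono fun x => ?_
    by_cases hx : 0 < x
    · by_cases hx1 : x < 1
      · rw [Set.indicator_of_mem (show x ∈ Set.Ioi 0 from hx),
          Set.indicator_of_mem (show x ∈ Set.Ioc 0 1 from ⟨hx, hx1.le⟩),
          ENNReal.ofReal_mul (mul_nonneg hC0 (sub_nonneg.2 hx1.le))]
        gcongr
        have h := hC ⟨x, hx.le, hx1⟩
        rw [← ENNReal.ofReal_toReal (measure_ne_top μ _)]
        exact ENNReal.ofReal_le_ofReal h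
      · have he : {a : Set.Ico (0 : ℝ) 1 | x ≤ (a : ℝ)} = ∅ :=
          Set.eq_empty_of_forall_notMem fun a ha => hx1 (lt_of_le_of_lt ha a.2.2)
        rw [Set.indicator_of_mem (show x ∈ Set.Ioi 0 from hx), he]
        simp
    · rw [Set.indicator_of_notMem (show x ∉ Set.Ioi 0 from hx)]
      exact zero_le
  have hval : ∫ x in (0 : ℝ)..1, C * (1 - x) * (((n : ℝ) + 1) * x ^ n) = C / ((n : ℝ) + 2) := by
    have he (x : ℝ) : C * (1 - x) * (((n : ℝ) + 1) * x ^ n) =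
        C * (n + 1) * (x ^ n - x ^ (n + 1)) := by ring
    simp only [he]
    rw [intervalIntegral.integral_const_mul, intervalIntegral.integral_sub (by simp) (by simp),
      integral_pow, integral_pow]
    push_cast
    simp only [one_pow, zero_pow (Nat.succ_ne_zero _), sub_zero]
    field_simp
    ring
  have hcont : Continuous fun x : ℝ => C * (1 - x) * (((n : ℝ) + 1) * x ^ n) := by fun_prop
  rw [← ofReal_integral_eq_lintegral_ofReal, ← intervalIntegral.integral_of_le zero_le_one,
    hval, ← hlayer, ENNReal.ofReal_le_ofReal_iff (by positivity)] at hbound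
  · refine hbound.trans_eq ?_
    push_cast
    ring
  · exact (hcont.intervalIntegrable 0 1).1
  · refine (ae_restrict_mem measurableSet_Ioc).mono fun x hx => ?_
    have := hx.1
    have := sub_nonneg.2 hx.2
    positivity

end Moments

/-! ### The operator and its resolvent on sequences -/

/-- The linear map `(aₙ) ↦ (mₙ ∑_{k ≤ n} a_k)` on sequences. -/
noncomputable def cesaroSeq (m : ℕ → ℂ) : (ℕ → ℂ) →ₗ[ℂ] (ℕ → ℂ) :=
  LinearMap.pi fun n => m n • ∑ k ∈ Finset.range (n + 1), LinearMap.proj k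

theorem cesaroSeq_apply (m a : ℕ → ℂ) (n : ℕ) :
    cesaroSeq m a n = m n * ∑ k ∈ Finset.range (n + 1), a k := by
  simp [cesaroSeq]

theorem PolyBound.norm_sum_le {k : ℕ} {A : ℝ} {a : ℕ → ℂ} (h : PolyBound k A a) (n : ℕ) :
    ‖∑ j ∈ Finset.range (n + 1), a j‖ ≤ A * ((n : ℝ) + 1) ^ (k + 1) := by
  have hA := h.nonneg
  calc _ ≤ ∑ j ∈ Finset.range (n + 1), A * ((n : ℝ) + 1) ^ k := by
        refine norm_sum_le_of_le _ fun j hj => (h j).trans ?_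
        have : (j : ℝ) ≤ n := by exact_mod_cast Finset.mem_range_succ_iff.1 hj
        gcongr
    _ = _ := by simp; ring

/-- Boundedness of `m` suffices: the power lost by summation is harmless in a union over all
exponents. -/
theorem polyBound_cesaroSeq {m : ℕ → ℂ} {M : ℝ} (hm : ∀ n, ‖m n‖ ≤ M) {k : ℕ} {A : ℝ} {a : ℕ → ℂ}
    (h : PolyBound k A a) : PolyBound (k + 1) (M * A) (cesaroSeq m a) := fun n => by
  rw [cesaroSeq_apply, norm_mul, mul_assoc]
  exact mul_le_mul (hm n) (h.norm_sum_le n) (norm_nonneg _) ((norm_nonneg _).trans (hm n))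

/-- The coefficients `rₙ = c / (c - mₙ)` of the recursion for the resolvent, with the value `1`
if `c = mₙ`. -/
noncomputable def resolventFactor (m : ℕ → ℂ) (c : ℂ) (n : ℕ) : ℂ := 1 + m n * (c - m n)⁻¹

/-- The solution `Sₙ` of `Sₙ = rₙ (Sₙ₋₁ + aₙ / c)`, as a linear functional of the sequence `a`. -/
noncomputable def resolventSum (m : ℕ → ℂ) (c : ℂ) : ℕ → ((ℕ → ℂ) →ₗ[ℂ] ℂ)
  | 0 => resolventFactor m c 0 • (c⁻¹ • LinearMap.proj 0)
  | n + 1 => resolventFactor m c (n + 1) • (resolventSum m c n + c⁻¹ • LinearMap.proj (n + 1))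

/-- The differences `bₙ = Sₙ - Sₙ₋₁`. -/
noncomputable def resolventSeq (m : ℕ → ℂ) (c : ℂ) : (ℕ → ℂ) →ₗ[ℂ] (ℕ → ℂ) :=
  LinearMap.pi fun
    | 0 => resolventSum m c 0
    | n + 1 => resolventSum m c (n + 1) - resolventSum m c n

section

variable {m : ℕ → ℂ} {c : ℂ}

theorem resolventSum_zero (a : ℕ → ℂ) :
    resolventSum m c 0 a = resolventFactor m c 0 * (c⁻¹ * a 0) := rfl

theorem resolventSum_succ (a : ℕ → ℂ) (n : ℕ) : resolventSum m c (n + 1) a =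
    resolventFactor m c (n + 1) * (resolventSum m c n a + c⁻¹ * a (n + 1)) := rfl

theorem resolventSeq_zero (a : ℕ → ℂ) : resolventSeq m c a 0 = resolventSum m c 0 a := rfl

theorem resolventSeq_succ (a : ℕ → ℂ) (n : ℕ) : resolventSeq m c a (n + 1) =
    resolventSum m c (n + 1) a - resolventSum m c n a := rfl

theorem sum_resolventSeq (a : ℕ → ℂ) (n : ℕ) :
    ∑ k ∈ Finset.range (n + 1), resolventSeq m c a k = resolventSum m c n a := by
  induction n with
  | zero => simp [resolventSeq_zero]
  | succ n ih => rw [Finset.sum_range_succ, ih, resolventSeq_succ]; ring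

theorem resolventFactor_mul {n : ℕ} (h : c ≠ m n) : resolventFactor m c n * (c - m n) = c := by
  have := sub_ne_zero.2 h
  rw [resolventFactor]
  field_simp
  ring

theorem resolventFactor_of_eq {n : ℕ} (h : c = m n) : resolventFactor m c n = 1 := by
  simp [resolventFactor, h]

/-- The equation `c b - C b = a` at the index `n` for `b = resolventSeq m c a`. -/
theorem sub_cesaroSeq_resolventSeq (hc : c ≠ 0) {n : ℕ} (h : c ≠ m n) (a : ℕ → ℂ) :
    c * resolventSeq m c a n - cesaroSeq m (resolventSeq m c a) n = a n := by
  have h1 := resolventFactor_mul h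
  have h2 : c * c⁻¹ = 1 := mul_inv_cancel₀ hc
  rw [cesaroSeq_apply, sum_resolventSeq]
  cases n with
  | zero =>
    rw [resolventSeq_zero, resolventSum_zero]
    linear_combination (c⁻¹ * a 0) * h1 + a 0 * h2
  | succ n =>
    rw [resolventSeq_succ, resolventSum_succ]
    linear_combination (resolventSum m c n a + c⁻¹ * a (n + 1)) * h1 + a (n + 1) * h2

/-- The partial sums of `a` satisfy the recursion with right-hand side `c a - C a`, and the
recursion has only one solution. -/
theorem resolventSum_sub_cesaroSeq (hc : c ≠ 0) (h : ∀ n, c ≠ m n) (a : ℕ → ℂ) (n : ℕ) :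
    resolventSum m c n (c • a - cesaroSeq m a) = ∑ k ∈ Finset.range (n + 1), a k := by
  have h2 : c * c⁻¹ = 1 := mul_inv_cancel₀ hc
  induction n with
  | zero =>
    have h1 := resolventFactor_mul (h 0)
    simp only [resolventSum_zero, Pi.sub_apply, Pi.smul_apply, smul_eq_mul, cesaroSeq_apply,
      zero_add, Finset.sum_range_one]
    linear_combination (c⁻¹ * a 0) * h1 + a 0 * h2
  | succ n ih =>
    have h1 := resolventFactor_mul (h (n + 1))
    rw [resolventSum_succ, ih]
    simp only [Pi.sub_apply, Pi.smul_apply, smul_eq_mul, cesaroSeq_apply,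
      Finset.sum_range_succ _ (n + 1)]
    set s := ∑ k ∈ Finset.range (n + 1), a k
    linear_combination (c⁻¹ * (s + a (n + 1))) * h1 +
      (s + a (n + 1) - resolventFactor m c (n + 1) * s) * h2

theorem resolventSeq_sub_cesaroSeq (hc : c ≠ 0) (h : ∀ n, c ≠ m n) (a : ℕ → ℂ) :
    resolventSeq m c (c • a - cesaroSeq m a) = a := by
  funext n
  cases n with
  | zero => rw [resolventSeq_zero, resolventSum_sub_cesaroSeq hc h]; simp
  | succ n =>
    rw [resolventSeq_succ, resolventSum_sub_cesaroSeq hc h, resolventSum_sub_cesaroSeq hc h,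
      Finset.sum_range_succ _ (n + 1)]
    ring

/-! ### Polynomial growth of the solutions of the recursion -/

theorem exists_norm_resolventFactor_le (hc : c ≠ 0) {C : ℝ}
    (hm : ∀ n : ℕ, ‖m n‖ ≤ C / ((n : ℝ) + 1)) :
    ∃ q : ℕ, ∀ n : ℕ, ‖resolventFactor m c n‖ ≤ (((n : ℝ) + 2) / (n + 1)) ^ q := by
  have hlim : Tendsto m atTop (𝓝 0) := by
    refine squeeze_zero_norm hm ?_
    simpa [div_eq_mul_inv] using tendsto_one_div_add_atTop_nhds_zero_nat.const_mul C
  have hinv : Tendsto (fun n => (c - m n)⁻¹) atTop (𝓝 c⁻¹) := by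
    have := (tendsto_const_nhds (x := c)).sub hlim
    rw [sub_zero] at this
    exact this.inv₀ hc
  -- The bound includes indices with `c = m n`, where the inverse is `0`; so the lemma also serves
  -- for eigenvalues.
  obtain ⟨D, hD⟩ := hinv.norm.bddAbove_range
  have hD : ∀ n, ‖(c - m n)⁻¹‖ ≤ D := fun n => hD ⟨n, rfl⟩
  obtain ⟨q, hq⟩ := exists_nat_ge (C * D)
  refine ⟨q, fun n => ?_⟩
  have hn : (0 : ℝ) < n + 1 := by positivity
  have h0 : 0 ≤ C / ((n : ℝ) + 1) := (norm_nonneg _).trans (hm n)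
  calc ‖resolventFactor m c n‖ ≤ ‖(1 : ℂ)‖ + ‖m n * (c - m n)⁻¹‖ := norm_add_le _ _
    _ ≤ 1 + C / ((n : ℝ) + 1) * D := by
        rw [norm_one, norm_mul]
        gcongr
        exacts [hm n, hD n]
    _ = 1 + C * D / ((n : ℝ) + 1) := by ring
    _ ≤ 1 + q * (1 / ((n : ℝ) + 1)) := by rw [mul_one_div]; gcongr
    -- Bernoulli's inequality puts the bound in a form whose products telescope.
    _ ≤ (1 + 1 / ((n : ℝ) + 1)) ^ q :=
        one_add_mul_le_pow (by have : 0 ≤ 1 / ((n : ℝ) + 1) := by positivity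
                               linarith) q
    _ = (((n : ℝ) + 2) / (n + 1)) ^ q := by congr 1; field_simp; ring

/-- The term `aⱼ / c` is multiplied by `rⱼ ⋯ rₙ`, whose bound telescopes to `((n+2)/(j+1))^q ≤
(n+2)^q`. -/
theorem norm_resolventSum_le {q : ℕ}
    (hq : ∀ n : ℕ, ‖resolventFactor m c n‖ ≤ (((n : ℝ) + 2) / (n + 1)) ^ q) {k : ℕ} {A : ℝ}
    {a : ℕ → ℂ} (ha : PolyBound k A a) (n : ℕ) :
    ‖resolventSum m c n a‖ ≤
      ((n : ℝ) + 2) ^ q * (‖c⁻¹‖ * ∑ j ∈ Finset.range (n + 1), A * ((j : ℝ) + 1) ^ k) := by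
  have hA := ha.nonneg
  induction n with
  | zero =>
    rw [resolventSum_zero, norm_mul, norm_mul]
    have h1 := hq 0
    have h2 := ha 0
    simp only [Nat.cast_zero, zero_add, div_one, one_pow, mul_one, Finset.sum_range_one] at h1 h2 ⊢
    gcongr
  | succ n ih =>
    have h1 := hq (n + 1)
    have h2 := ha (n + 1)
    rw [resolventSum_succ, norm_mul, Finset.sum_range_succ _ (n + 1)]
    set s := ∑ j ∈ Finset.range (n + 1), A * ((j : ℝ) + 1) ^ k
    set x := A * (((n + 1 : ℕ) : ℝ) + 1) ^ k
    have hx : 0 ≤ x := (norm_nonneg _).trans h2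
    push_cast at h1 ⊢
    have h3 : ((n : ℝ) + 1 + 2) / (n + 1 + 1) = ((n : ℝ) + 1 + 2) / (n + 2) := by ring
    rw [h3] at h1
    have h4 : (1 : ℝ) ≤ ((n : ℝ) + 2) ^ q := one_le_pow₀ (by linarith [n.cast_nonneg (α := ℝ)])
    calc _ ≤ (((n : ℝ) + 1 + 2) / (n + 2)) ^ q *
          (((n : ℝ) + 2) ^ q * (‖c⁻¹‖ * s) + ((n : ℝ) + 2) ^ q * (‖c⁻¹‖ * x)) := by
          refine mul_le_mul h1 ((norm_add_le _ _).trans (add_le_add ih ?_)) (norm_nonneg _)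
            (by positivity)
          rw [norm_mul]
          refine (mul_le_mul_of_nonneg_left h2 (norm_nonneg _)).trans ?_
          exact le_mul_of_one_le_left (by positivity) h4
      _ = _ := by
          rw [div_pow]
          field_simp

/-- The exponent collects `q` from the product and `k + 1` from the summation; `2 ^ q` comes from `n
+ 2 ≤ 2 (n + 1)` and the other `2` from taking differences. -/
theorem polyBound_resolventSeq {q : ℕ}
    (hq : ∀ n : ℕ, ‖resolventFactor m c n‖ ≤ (((n : ℝ) + 2) / (n + 1)) ^ q) {k : ℕ} {A : ℝ}
    {a : ℕ → ℂ} (ha : PolyBound k A a) :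
    PolyBound (q + (k + 1)) (2 * 2 ^ q * ‖c⁻¹‖ * A) (resolventSeq m c a) := by
  have hA := ha.nonneg
  have hS (n : ℕ) : ‖resolventSum m c n a‖ ≤ 2 ^ q * ‖c⁻¹‖ * A * ((n : ℝ) + 1) ^ (q + (k + 1)) := by
    have hs : ∑ j ∈ Finset.range (n + 1), A * ((j : ℝ) + 1) ^ k ≤ A * ((n : ℝ) + 1) ^ (k + 1) :=
      calc _ ≤ ∑ j ∈ Finset.range (n + 1), A * ((n : ℝ) + 1) ^ k := by
            refine Finset.sum_le_sum fun j hj => ?_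
            have : (j : ℝ) ≤ n := by exact_mod_cast Finset.mem_range_succ_iff.1 hj
            gcongr
        _ = _ := by simp; ring
    calc _ ≤ ((n : ℝ) + 2) ^ q * (‖c⁻¹‖ * ∑ j ∈ Finset.range (n + 1), A * ((j : ℝ) + 1) ^ k) :=
          norm_resolventSum_le hq ha n
      _ ≤ (2 * ((n : ℝ) + 1)) ^ q * (‖c⁻¹‖ * (A * ((n : ℝ) + 1) ^ (k + 1))) := by
          gcongr
          linarith [n.cast_nonneg (α := ℝ)]
      _ = _ := by rw [mul_pow, pow_add]; ring
  have hB : 0 ≤ 2 ^ q * ‖c⁻¹‖ * A := by positivity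
  intro n
  cases n with
  | zero =>
    refine (hS 0).trans ?_
    gcongr
    linarith [show 0 ≤ (2 : ℝ) ^ q by positivity]
  | succ n =>
    rw [resolventSeq_succ]
    calc _ ≤ ‖resolventSum m c (n + 1) a‖ + ‖resolventSum m c n a‖ := norm_sub_le _ _
      _ ≤ 2 ^ q * ‖c⁻¹‖ * A * (((n + 1 : ℕ) : ℝ) + 1) ^ (q + (k + 1)) +
          2 ^ q * ‖c⁻¹‖ * A * (((n + 1 : ℕ) : ℝ) + 1) ^ (q + (k + 1)) := by
          refine add_le_add (hS _) ((hS n).trans ?_)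
          gcongr
          simp
      _ = _ := by ring

/-- For `c = m_p` the solution of the recursion with right-hand side supported at `p` is an
eigenvector. -/
theorem exists_cesaroSeq_eigenvector (hm : Function.Injective m) {p : ℕ} (hp : m p ≠ 0) :
    resolventSeq m (m p) (Pi.single p 1) ≠ 0 ∧
      cesaroSeq m (resolventSeq m (m p) (Pi.single p 1)) =
        m p • resolventSeq m (m p) (Pi.single p 1) := by
  set c := m p with hc
  set a : ℕ → ℂ := Pi.single p 1
  have hlt : ∀ n < p, resolventSum m c n a = 0 := by
    intro n
    induction n with
    | zero =>
      intro h
      rw [resolventSum_zero, show a 0 = 0 from Pi.single_eq_of_ne h.ne 1]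
      simp
    | succ n ih =>
      intro h
      rw [resolventSum_succ, ih (by omega), show a (n + 1) = 0 from Pi.single_eq_of_ne h.ne 1]
      simp
  -- The default value `r_p = 1` makes the solution start at `p` with a nonzero entry.
  have hSp : resolventSum m c p a = c⁻¹ := by
    have h1 := resolventFactor_of_eq hc
    have h2 : a p = 1 := Pi.single_eq_same p 1
    cases p with
    | zero => rw [resolventSum_zero, h1, h2]; simp
    | succ n => rw [resolventSum_succ, h1, h2, hlt n n.lt_succ_self]; simp
  have hbp : resolventSeq m c a p = c⁻¹ := by
    cases p with
    | zero => rw [resolventSeq_zero, hSp]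
    | succ n => rw [resolventSeq_succ, hSp, hlt n n.lt_succ_self, sub_zero]
  refine ⟨fun h => inv_ne_zero hp (hbp ▸ congrFun h p), funext fun n => ?_⟩
  rw [Pi.smul_apply, smul_eq_mul]
  by_cases hn : n = p
  -- At `p` the resolvent equation is unavailable, but `b_p = S_p` gives the eigenvalue equation
  -- directly. Elsewhere `m n ≠ c` and the right-hand side is `0`.
  · rw [hn, cesaroSeq_apply, sum_resolventSeq, hSp, hbp]
  · have h1 := sub_cesaroSeq_resolventSeq (m := m) hp (n := n) (hm.ne (Ne.symm hn)) a
    rw [show a n = 0 from Pi.single_eq_of_ne hn 1] at h1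
    exact (sub_eq_zero.1 h1).symm

theorem cesaroSeq_injective (hm : ∀ n, m n ≠ 0) : Function.Injective (cesaroSeq m) := by
  refine (injective_iff_map_eq_zero _).2 fun a ha => ?_
  have hs (n : ℕ) : ∑ k ∈ Finset.range (n + 1), a k = 0 := by
    have := congrFun ha n
    rw [cesaroSeq_apply] at this
    exact (mul_eq_zero.1 this).resolve_left (hm n)
  funext n
  cases n with
  | zero => simpa using hs 0
  | succ n => simpa [Finset.sum_range_succ _ (n + 1), hs n] using hs (n + 1)

end

end KorenblumCesaro

/-! ### The spectrum on `A^{-∞}` -/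

open KorenblumCesaro in
theorem mainTheorem12
    (μ : MeasureTheory.Measure (Set.Ico (0 : ℝ) 1)) [MeasureTheory.IsFiniteMeasure μ]
    (hμ_pos : 0 < μ {t | 0 < (t : ℝ)})
    (hμ : KorenblumCesaro.IsCarleson μ) :
    ∃ T : KorenblumCesaro.Korenblum →L[ℂ] KorenblumCesaro.Korenblum,
      KorenblumCesaro.IsCesaroOperator μ T ∧
      spectrum ℂ T \ {0} = Set.range (fun n : ℕ => (KorenblumCesaro.moment μ n : ℂ)) ∧
      KorenblumCesaro.pointSpectrum T =
        Set.range (fun n : ℕ => (KorenblumCesaro.moment μ n : ℂ)) ∧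
      ∀ c : ℂ, c ∉ Set.range (fun n : ℕ => (KorenblumCesaro.moment μ n : ℂ)) ∪ {0} →
        c ∈ resolventSet ℂ T := by
  set m : ℕ → ℂ := fun n => (moment μ n : ℂ)
  have hm_ne (n : ℕ) : m n ≠ 0 := Complex.ofReal_ne_zero.2 (moment_pos hμ_pos n).ne'
  have hm_inj : Function.Injective m :=
    Complex.ofReal_injective.comp (moment_strictAnti hμ_pos).injective
  obtain ⟨C, hC0, hC⟩ := hμ.exists_moment_le
  have hm (n : ℕ) : ‖m n‖ ≤ C / ((n : ℝ) + 1) := by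
    rw [Complex.norm_of_nonneg (moment_nonneg μ n)]
    exact hC n
  have hmC (n : ℕ) : ‖m n‖ ≤ C := (hm n).trans (div_le_self hC0 (by simp))
  obtain ⟨T, hT⟩ := Korenblum.exists_continuousLinearMap (cesaroSeq m)
    fun k => ⟨k + 1, C, fun _ _ h => polyBound_cesaroSeq hmC h⟩
  have hres (c : ℂ) (hc : c ∉ Set.range m ∪ {0}) : c ∈ resolventSet ℂ T := by
    have hc0 : c ≠ 0 := fun h => hc (Or.inr h)
    have hcm (n : ℕ) : c ≠ m n := fun h => hc (Or.inl ⟨n, h.symm⟩)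
    obtain ⟨q, hq⟩ := exists_norm_resolventFactor_le hc0 hm
    obtain ⟨R, hR⟩ := Korenblum.exists_continuousLinearMap (resolventSeq m c)
      fun k => ⟨_, _, fun _ _ h => polyBound_resolventSeq hq h⟩
    refine isUnit_iff_exists.2 ⟨R, ?_, ?_⟩
    · refine ContinuousLinearMap.ext fun f => Korenblum.coeffLM_injective (funext fun n => ?_)
      have h := sub_cesaroSeq_resolventSeq hc0 (hcm n) (Korenblum.coeffLM f)
      rw [← hR, ← hT] at h
      simpa [Algebra.algebraMap_eq_smul_one] using h
    · refine ContinuousLinearMap.ext fun f => Korenblum.coeffLM_injective ?_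
      have h := resolventSeq_sub_cesaroSeq hc0 hcm (Korenblum.coeffLM f)
      rw [← hT, ← map_smul, ← map_sub, ← hR] at h
      simpa [Algebra.algebraMap_eq_smul_one] using h
  have heig (p : ℕ) : ∃ f, f ≠ 0 ∧ T f = m p • f := by
    obtain ⟨q, hq⟩ := exists_norm_resolventFactor_le (hm_ne p) hm
    obtain ⟨hne, hb⟩ := exists_cesaroSeq_eigenvector hm_inj (hm_ne p)
    have hsingle : PolyBound 0 1 (Pi.single p (1 : ℂ)) := fun n => by
      by_cases hn : n = p
      · simp [hn]
      · simp [Pi.single_eq_of_ne hn]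
    -- Polynomial growth turns the formal eigenvector into an element of `A^{-∞}`.
    obtain ⟨f, hf⟩ := Korenblum.mem_range_coeffLM (polyBound_resolventSeq hq hsingle)
    rw [← hf] at hne hb
    refine ⟨f, fun h => hne (by rw [h, map_zero]), Korenblum.coeffLM_injective ?_⟩
    rw [hT, hb, map_smul]
  have hpoint (p : ℕ) : m p ∈ pointSpectrum T := fun hinj => by
    obtain ⟨f, hf0, hf⟩ := heig p
    exact hf0 (hinj (by simp [hf]))
  have hunit (c : ℂ) (hc : c ∈ resolventSet ℂ T) : c ∉ pointSpectrum T := by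
    obtain ⟨R, -, hR⟩ := isUnit_iff_exists.1 hc
    refine fun h => h (Function.LeftInverse.injective (g := R) fun f => ?_)
    simpa [Algebra.algebraMap_eq_smul_one] using DFunLike.congr_fun hR f
  have hzero : (0 : ℂ) ∉ pointSpectrum T := fun h => h fun f g hfg => by
    refine Korenblum.coeffLM_injective (cesaroSeq_injective hm_ne ?_)
    rw [← hT, ← hT]
    exact congrArg _ (by simpa using hfg)
  refine ⟨T, fun f z => ?_, ?_, ?_, hres⟩
  · have h := hasSum_coeff (T f).mem_holomorphic z
    refine h.congr_fun fun n => ?_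
    rw [← Korenblum.coeffLM_apply (T f), hT, cesaroSeq_apply]
    rfl
  · refine Set.Subset.antisymm (fun c hc => ?_) ?_
    · by_contra hcm
      exact hc.1 (hres c fun h => h.elim hcm hc.2)
    · rintro _ ⟨p, rfl⟩
      exact ⟨fun h => hunit _ h (hpoint p), hm_ne p⟩
  · refine Set.Subset.antisymm (fun c hc => ?_) ?_
    · by_contra hcm
      refine hunit c (hres c fun h => h.elim hcm fun h0 => hzero ?_) hc
      rwa [← Set.mem_singleton_iff.1 h0]
    · rintro _ ⟨p, rfl⟩
      exact hpoint p
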